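/- **Setting.** Nodes $0,1,\dots,n-1$ are points $x_0,\dots,x_{n-1}\in\mathbb{R}^D$, fixed in advance. Node $i$ arrives at time $i$ and has a deadline $d_i\in\mathbb{N}$ with $d_i>i$ and $d_0\le d_1\le\dots\le d_{n-1}$ (for example, every node stays in the market for the same length of time). The edge between nodes $i$ and $j$ has weight $\|x_i-x_j\|_2$. Each node has a seller copy and a buyer copy; the seller copy of $i$ can be matched with the buyer copy of $j$ iff $i<j<d_i$, i.e. iff $j$ arrives after $i$ and while $i$ is still in the market. Let $\mathrm{OPT}$ be the maximum weight of a (not necessarily perfect) matching in this bipartite graph; it is at least the maximum weight of a matching of the nodes themselves by such pairs. **Algorithm FastPostponedGreedy** (parameters $\epsilon,\delta\in(0,1)$ and $C>0$). Let $s=\lceil C\epsilon^{-2}\log(n/\delta)\rceil$ and draw $M\in\{-1/\sqrt s,+1/\sqrt s\}^{s\times D}$ with independent uniform entries. Put $\widetilde w_{i,j}=\|Mx_i-Mx_j\|_2$, and start with total $p=0$. At each time $t=0,1,2,\dots$ until all deadlines have passed: 1. If $t<n$, node $t$ arrives with undetermined status; its seller and buyer copies enter the market, its seller copy has no tentative partner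 and value $w_t=0$. 2. For every node $i$ with $d_i=t$, in order of arrival: if its status is undetermined, it becomes seller or buyer with probability $1/2$ each, independently. If its seller copy is tentatively matched to the buyer copy of a node $l$, then: if $i$ is a seller, the pair $(i,l)$ is finalized, $w_i$ is added to $p$ and $l$ becomes a buyer; if $i$ is a buyer, $l$ becomes a seller. Both copies of $i$ leave the market. 3. If $t<n$, choose among the seller copies in the market one, $j$, that maximizes $\widetilde w_{t,j}-w_j$ (ties are broken by an arbitrary fixed rule). If $j\ne t$, the buyer copy of $t$ becomes the tentative partner of the seller copy of $j$ (replacing a previous one) and $w_j\leftarrow\max\{w_j,\widetilde w_{t,j}\}$; if $j=t$, the buyer copy of $t$ stays unmatched. **Theorem.** There is an absolute constant $C_0>0$ such that for all $C\ge C_0$, all $\epsilon,\delta\in(0,1)$, all $n$, $D$, all inputs $(x_i),(d_i)$ as above and every tie-breaking rule, FastPostponedGreedy is $\frac{1-\epsilon}{4}$-competitive with probability at least $1-\delta$. That is: * the finalized pairs always form a matching of the nodes: every finalized pair $(i,l)$ satisfies $i<l<d_i$, and no node lies in two of them; * with probability at least $1-\delta$ over the choice of $M$, the expectations over the role coins satisfy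 $$\mathbb{E}\Big[\sum_{(i,l)\text{ finalized}}\|x_i-x_l\|_2\Big]\ \ge\ \frac{1-\epsilon}{4}\,\mathrm{OPT}\qquad\text{and}\qquad \mathbb{E}[p]\ \ge\ \frac{1-\epsilon}{4}\,\mathrm{OPT},$$ where $p$ is the final total returned by the algorithm. -/

import Mathlib

open scoped BigOperators

noncomputable section

namespace FPG

/-! ### The market

Node `i : Fin n` arrives at time `i`, is a point of `ℝ^D`, and leaves the market at time `d i`
(its deadline): it can be matched with exactly the nodes that arrive while it is in the market. -/

/-- True weight of an edge: the Euclidean distance of its endpoints. -/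
def edgeWeight {n D : ℕ} (x : Fin n → EuclideanSpace ℝ (Fin D)) (i j : Fin n) : ℝ :=
  ‖x j - x i‖

/-- True weight of a set of (seller, buyer) pairs. -/
def totalWeight {n D : ℕ} (x : Fin n → EuclideanSpace ℝ (Fin D))
    (N : Finset (Fin n × Fin n)) : ℝ :=
  ∑ e ∈ N, edgeWeight x e.1 e.2

/-- `N` is a matching of the bipartite graph whose sides are the `n` seller copies and the `n`
buyer copies of the nodes, with an edge from the seller copy of `i` to the buyer copy of `j`
whenever `j` arrives after `i` and before the deadline of `i`. -/
def IsCopyMatching {n : ℕ} (d : Fin n → ℕ) (N : Finset (Fin n × Fin n)) : Prop :=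
  (∀ e ∈ N, e.1 < e.2 ∧ (e.2 : ℕ) < d e.1) ∧
  (∀ e ∈ N, ∀ e' ∈ N, e.1 = e'.1 → e = e') ∧
  (∀ e ∈ N, ∀ e' ∈ N, e.2 = e'.2 → e = e')

/-- `N` is a matching of the nodes themselves (each pair written with the earlier node first):
moreover no node is used both as a seller and as a buyer. -/
def IsNodeMatching {n : ℕ} (d : Fin n → ℕ) (N : Finset (Fin n × Fin n)) : Prop :=
  IsCopyMatching d N ∧ ∀ e ∈ N, ∀ e' ∈ N, e.1 ≠ e'.2

/-- The offline optimum: the largest true weight of a matching between seller copies and buyer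
copies. Every node matching is such a matching, so this is at least the largest true weight of
a matching of the nodes, whatever roles the nodes are given. -/
def opt {n D : ℕ} (x : Fin n → EuclideanSpace ℝ (Fin D)) (d : Fin n → ℕ) : ℝ :=
  sSup {r : ℝ | ∃ N : Finset (Fin n × Fin n), IsCopyMatching d N ∧ r = totalWeight x N}

/-! ### The sketch -/

/-- The number of rows of the sketching matrix, `⌈C ε⁻² log (n / δ)⌉`. -/
def sketchDim (C ε δ : ℝ) (n : ℕ) : ℕ :=
  ⌈C * (ε ^ 2)⁻¹ * Real.log (n / δ)⌉₊

/-- The matrix with entries `1 / √s` (where `signs` is true) and `- 1 / √s` (where it is false). -/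
def sketchMatrix {s D : ℕ} (signs : Fin s → Fin D → Bool) : Matrix (Fin s) (Fin D) ℝ :=
  Matrix.of fun i j => if signs i j then 1 / Real.sqrt s else -(1 / Real.sqrt s)

/-- The sketch `M v` of a point `v`. -/
def sketch {s D : ℕ} (M : Matrix (Fin s) (Fin D) ℝ) (v : EuclideanSpace ℝ (Fin D)) :
    EuclideanSpace ℝ (Fin s) :=
  WithLp.toLp 2 (Matrix.mulVec M v.ofLp)

/-- Approximate weight of the edge between the seller copy of `j` and the buyer copy of `i`. -/
def query {n s D : ℕ} (M : Matrix (Fin s) (Fin D) ℝ) (x : Fin n → EuclideanSpace ℝ (Fin D))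
    (i j : Fin n) : ℝ :=
  ‖sketch M (x i) - sketch M (x j)‖

/-! ### The algorithm -/

/-- The role of a node, once it is determined. -/
inductive Role : Type where
  | seller : Role
  | buyer : Role

/-- The data structure. -/
structure State (n : ℕ) where
  /-- nodes whose seller copy is in the market -/
  sellers : Finset (Fin n)
  /-- nodes whose buyer copy is in the market -/
  buyers : Finset (Fin n)
  /-- the node whose buyer copy is tentatively matched to the seller copy of the given node -/
  partner : Fin n → Option (Fin n)
  /-- the current (approximate) matching value of each seller copy -/
  value : Fin n → ℝ
  /-- the status of each node, `none` while it is undetermined -/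
  status : Fin n → Option Role
  /-- the total (approximate) matching value -/
  p : ℝ
  /-- the finalized (seller, buyer) pairs -/
  matching : Finset (Fin n × Fin n)

/-- The state before the first arrival. -/
def State.init (n : ℕ) : State n where
  sellers := ∅
  buyers := ∅
  partner := fun _ => none
  value := fun _ => 0
  status := fun _ => none
  p := 0
  matching := ∅

/-- Node `i` arrives: its status is undetermined, both copies enter the market. -/
def State.arrive {n : ℕ} (σ : State n) (i : Fin n) : State n :=
  { σ with
    sellers := insert i σ.sellers
    buyers := insert i σ.buyers
    partner := Function.update σ.partner i none
    value := Function.update σ.value i 0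
    status := Function.update σ.status i none }

/-- The deadline of node `i`. If its status is undetermined, its coin decides (true: seller).
If its seller copy is tentatively matched to `l`: when `i` is a seller, the pair `(i, l)` is
finalized, its value is collected and `l` becomes a buyer; when `i` is a buyer, `l` becomes a
seller. Both copies of `i` leave the market. -/
def State.expire {n : ℕ} (coins : Fin n → Bool) (σ : State n) (i : Fin n) : State n :=
  let role : Role := (σ.status i).getD (if coins i then Role.seller else Role.buyer)
  let σ₁ : State n := { σ with status := Function.update σ.status i (some role) }
  let σ₂ : State n :=
    match σ.partner i with
    | none => σ₁
    | some l =>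
      match role with
      | Role.seller =>
        { σ₁ with
          p := σ₁.p + σ₁.value i
          matching := insert (i, l) σ₁.matching
          status := Function.update σ₁.status l (some Role.buyer) }
      | Role.buyer =>
        { σ₁ with status := Function.update σ₁.status l (some Role.seller) }
  { σ₂ with sellers := σ₂.sellers.erase i, buyers := σ₂.buyers.erase i }

/-- All deadlines of time `t`, in the order of arrival of the nodes. -/
def State.expireAll {n : ℕ} (d : Fin n → ℕ) (coins : Fin n → Bool) (t : ℕ) (σ : State n) :
    State n :=
  ((List.finRange n).filter fun i => d i = t).foldl (State.expire coins) σ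

/-- `sel S f` is a point of `S` where `f` is largest; ties are broken in any fixed way. -/
def IsArgmaxRule {n : ℕ} (sel : Finset (Fin n) → (Fin n → ℝ) → Fin n) : Prop :=
  ∀ (S : Finset (Fin n)) (f : Fin n → ℝ), S.Nonempty →
    sel S f ∈ S ∧ ∀ j ∈ S, f j ≤ f (sel S f)

/-- The buyer copy of the new node `i` is tentatively matched to the seller copy in the market
with the largest increment of the approximate matching value. The own seller copy of `i` is in
the market with increment `0`; when it is the one selected, the buyer copy stays unmatched. -/
def State.assign {n : ℕ} (sel : Finset (Fin n) → (Fin n → ℝ) → Fin n) (w : Fin n → ℝ)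
    (σ : State n) (i : Fin n) : State n :=
  let j := sel σ.sellers fun j => w j - σ.value j
  if j = i then σ
  else
    { σ with
      partner := Function.update σ.partner j (some i)
      value := Function.update σ.value j (max (σ.value j) (w j)) }

/-- Everything that happens at time `t`: the arrival of node `t` (if `t < n`), the deadlines,
and the tentative matching of the buyer copy of the new node. -/
def step {n s D : ℕ} (x : Fin n → EuclideanSpace ℝ (Fin D)) (d : Fin n → ℕ)
    (sel : Finset (Fin n) → (Fin n → ℝ) → Fin n) (M : Matrix (Fin s) (Fin D) ℝ)
    (coins : Fin n → Bool) (t : ℕ) (σ : State n) : State n :=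
  if h : t < n then
    ((σ.arrive ⟨t, h⟩).expireAll d coins t).assign sel (query M x ⟨t, h⟩) ⟨t, h⟩
  else σ.expireAll d coins t

/-- The state after the times `0, …, T - 1`. -/
def run {n s D : ℕ} (x : Fin n → EuclideanSpace ℝ (Fin D)) (d : Fin n → ℕ)
    (sel : Finset (Fin n) → (Fin n → ℝ) → Fin n) (M : Matrix (Fin s) (Fin D) ℝ)
    (coins : Fin n → Bool) : ℕ → State n
  | 0 => State.init n
  | T + 1 => step x d sel M coins T (run x d sel M coins T)

/-- The final state, when every node has passed its deadline. -/
def final {n s D : ℕ} (x : Fin n → EuclideanSpace ℝ (Fin D)) (d : Fin n → ℕ)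
    (sel : Finset (Fin n) → (Fin n → ℝ) → Fin n) (M : Matrix (Fin s) (Fin D) ℝ)
    (coins : Fin n → Bool) : State n :=
  run x d sel M coins (Finset.univ.sup fun i => d i + 1)

/-- Expectation over `n` independent fair coins. -/
def coinExpect {n : ℕ} (f : (Fin n → Bool) → ℝ) : ℝ :=
  𝔼 coins : Fin n → Bool, f coins

/-- The law of `s * D` independent uniformly random signs. -/
def signLaw (s D : ℕ) : MeasureTheory.Measure (Fin s → Fin D → Bool) :=
  (PMF.uniformOfFintype (Fin s → Fin D → Bool)).toMeasure

end FPG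

end

/-! The coins affect roles only: once the sketch is fixed, the seller copies in the market, the
tentative partners and the values evolve deterministically. Compare the run on given coins with the
run on all coins flipped. Every role is reversed, so each tentative pair in place when its seller
leaves is finalized in exactly one of the two runs (`Coupled.expire`). Together the runs collect the
sum V of all final values. Flipping permutes the coin vectors, so one run collects V/2 on average
(`le_coinExpect`).

Greedy loses another factor 2. An edge (i, t) of a competing matching was available when t arrived,
so its sketched weight is at most the value of i plus the increase of the total value at that
moment. Values never decrease and each i is used at most once, so the competing matching has
sketched weight at most 2V (`run_spec`, `final_spec`).

Monotone deadlines make sellers leave in order of arrival. A role imposed on a partner therefore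
comes before that partner's own deadline and is never contradicted, which makes the finalized pairs
a node matching (`Valid.expire`, `isNodeMatching_of_valid`).

Finally, Chernoff bounds for squares of random signed sums and a union bound over pairs give
distortion at most η = ε/2 for all distances at once (`le_signLaw_faithful`). This costs a factor (1
- η)/(1 + η) ≥ 1 - ε. -/

namespace FPG

variable {n : ℕ}

/-! ### Effect of a single deadline on the state -/

/-- The opposite role. -/
def Role.flip : Role → Role
  | .seller => .buyer
  | .buyer => .seller

/-- The nodes among the first `a` whose seller copy is no longer in the market. -/
def State.expired (σ : State n) (a : ℕ) : Finset (Fin n) :=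
  Finset.univ.filter fun i => (i : ℕ) < a ∧ i ∉ σ.sellers

theorem State.mem_expired {σ : State n} {a : ℕ} {i : Fin n} :
    i ∈ σ.expired a ↔ (i : ℕ) < a ∧ i ∉ σ.sellers := by
  simp [State.expired]

@[simp] theorem expire_sellers (c : Fin n → Bool) (σ : State n) (i : Fin n) :
    (σ.expire c i).sellers = σ.sellers.erase i := by
  unfold State.expire; dsimp only; split <;> [skip; split] <;> rfl

@[simp] theorem expire_partner (c : Fin n → Bool) (σ : State n) (i : Fin n) :
    (σ.expire c i).partner = σ.partner := by
  unfold State.expire; dsimp only; split <;> [skip; split] <;> rfl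

@[simp] theorem expire_value (c : Fin n → Bool) (σ : State n) (i : Fin n) :
    (σ.expire c i).value = σ.value := by
  unfold State.expire; dsimp only; split <;> [skip; split] <;> rfl

/-- The role of node `i` when it leaves the market. -/
def State.role (c : Fin n → Bool) (σ : State n) (i : Fin n) : Role :=
  (σ.status i).getD (if c i then Role.seller else Role.buyer)

theorem expire_none {c : Fin n → Bool} {σ : State n} {i : Fin n} (h : σ.partner i = none) :
    (σ.expire c i).status = Function.update σ.status i (some (σ.role c i)) ∧
    (σ.expire c i).p = σ.p ∧ (σ.expire c i).matching = σ.matching := by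
  unfold State.expire; simp only [h]; exact ⟨rfl, trivial, trivial⟩

theorem expire_seller {c : Fin n → Bool} {σ : State n} {i l : Fin n} (h : σ.partner i = some l)
    (hr : σ.role c i = .seller) :
    (σ.expire c i).status =
      Function.update (Function.update σ.status i (some .seller)) l (some .buyer) ∧
    (σ.expire c i).p = σ.p + σ.value i ∧
    (σ.expire c i).matching = insert (i, l) σ.matching := by
  unfold State.role at hr
  unfold State.expire; simp only [h, hr]; exact ⟨trivial, trivial, trivial⟩

theorem expire_buyer {c : Fin n → Bool} {σ : State n} {i l : Fin n} (h : σ.partner i = some l)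
    (hr : σ.role c i = .buyer) :
    (σ.expire c i).status =
      Function.update (Function.update σ.status i (some .buyer)) l (some .seller) ∧
    (σ.expire c i).p = σ.p ∧ (σ.expire c i).matching = σ.matching := by
  unfold State.role at hr
  unfold State.expire; simp only [h, hr]; exact ⟨trivial, trivial, trivial⟩

/-! ### Invariants of one run -/

/-- What every reachable state satisfies: `a` nodes have arrived, the buyer copies of the first
`b` of them have been assigned, and the weights are `W`. -/
structure Valid (d : Fin n → ℕ) (W : Fin n → Fin n → ℝ) (a b : ℕ) (σ : State n) : Prop where
  le : b ≤ a
  sellers_lt : ∀ i ∈ σ.sellers, (i : ℕ) < a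
  -- First in, first out: this protects the statuses of finalized pairs from later overwriting.
  expired_lt : ∀ k : Fin n, (k : ℕ) < a → k ∉ σ.sellers → ∀ j ∈ σ.sellers, k < j
  partner_spec : ∀ i l, σ.partner i = some l →
    i < l ∧ (l : ℕ) < b ∧ (l : ℕ) < d i ∧ σ.value i = W l i
  partner_inj : ∀ i i' l, σ.partner i = some l → σ.partner i' = some l → i = i'
  value_none : ∀ i, σ.partner i = none → σ.value i = 0
  matching_spec : ∀ e ∈ σ.matching, ((e.1 : ℕ) < a ∧ e.1 ∉ σ.sellers) ∧
    σ.partner e.1 = some e.2 ∧ σ.status e.1 = some .seller ∧ σ.status e.2 = some .buyer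

variable {d : Fin n → ℕ} {W : Fin n → Fin n → ℝ} {a b : ℕ} {σ σ' : State n}

theorem Valid.init : Valid d W 0 0 (State.init n) := by
  constructor <;> simp [State.init]

theorem Valid.partner_of_le (h : Valid d W a b σ) {i : Fin n} (hi : a ≤ i) :
    σ.partner i = none := by
  rcases hp : σ.partner i with _ | l
  · rfl
  · have h1 := h.partner_spec i l hp
    have h2 := h.le
    have : (i : ℕ) < l := h1.1
    omega

theorem Valid.value_nonneg (hW : ∀ i j, 0 ≤ W i j) (h : Valid d W a b σ) (i : Fin n) :
    0 ≤ σ.value i := by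
  rcases hp : σ.partner i with _ | l
  · rw [h.value_none i hp]
  · rw [(h.partner_spec i l hp).2.2.2]; exact hW _ _

/-- The reset at arrival is vacuous: a partner arrives later than its seller, so a node that has not
arrived has none. -/
theorem Valid.arrive_partner (h : Valid d W a b σ) (ha : a < n) :
    (σ.arrive ⟨a, ha⟩).partner = σ.partner := by
  have h1 := h.partner_of_le (i := ⟨a, ha⟩) le_rfl
  show Function.update _ _ _ = _
  rw [← h1, Function.update_eq_self]

theorem Valid.arrive_value (h : Valid d W a b σ) (ha : a < n) :
    (σ.arrive ⟨a, ha⟩).value = σ.value := by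
  have h1 := h.value_none _ (h.partner_of_le (i := ⟨a, ha⟩) le_rfl)
  show Function.update _ _ _ = _
  rw [← h1, Function.update_eq_self]

theorem Valid.arrive (h : Valid d W a b σ) (ha : a < n) :
    Valid d W (a + 1) b (σ.arrive ⟨a, ha⟩) := by
  have hs : (σ.arrive ⟨a, ha⟩).sellers = insert ⟨a, ha⟩ σ.sellers := rfl
  have hm : (σ.arrive ⟨a, ha⟩).matching = σ.matching := rfl
  have ht : (σ.arrive ⟨a, ha⟩).status = Function.update σ.status ⟨a, ha⟩ none := rfl
  have hle := h.le
  refine ⟨by omega, ?_, ?_, ?_, ?_, ?_, ?_⟩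
  · intro i hi
    rw [hs, Finset.mem_insert] at hi
    rcases hi with rfl | hi
    · simp
    · have := h.sellers_lt i hi; omega
  · intro k hk hks j hj
    rw [hs, Finset.mem_insert] at hks hj
    push Not at hks
    have hka : (k : ℕ) < a := by
      have : (k : ℕ) ≠ a := fun e => hks.1 (Fin.ext e)
      omega
    rcases hj with rfl | hj
    · exact hka
    · exact h.expired_lt k hka hks.2 j hj
  · rw [h.arrive_partner, h.arrive_value]; exact h.partner_spec
  · rw [h.arrive_partner]; exact h.partner_inj
  · rw [h.arrive_partner, h.arrive_value]; exact h.value_none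
  · intro e he
    rw [hm] at he
    obtain ⟨⟨h1, h2⟩, h3, h4, h5⟩ := h.matching_spec e he
    have h6 := h.partner_spec _ _ h3
    have n1 : e.1 ≠ ⟨a, ha⟩ := fun q => by rw [q] at h1; simp at h1
    have n2 : e.2 ≠ ⟨a, ha⟩ := fun q => by
      have := h6.2.1
      rw [q] at this; simp at this; omega
    rw [h.arrive_partner, hs, ht, Function.update_of_ne n1, Function.update_of_ne n2]
    refine ⟨⟨by omega, ?_⟩, h3, h4, h5⟩
    simp [n1, h2]

/-- Only the statuses of `i` and of its later partner are rewritten. Sellers of finalized pairs left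
before and are older than `i`, and by `partner_inj` their buyers differ from the partner of `i`. -/
theorem Valid.expire (h : Valid d W a b σ) (c : Fin n → Bool) {i : Fin n} (hi : i ∈ σ.sellers)
    (hmin : ∀ j ∈ σ.sellers, i ≤ j) : Valid d W a b (σ.expire c i) := by
  refine ⟨h.le, ?_, ?_, ?_, ?_, ?_, ?_⟩
  · intro j hj
    rw [expire_sellers] at hj
    exact h.sellers_lt j (Finset.mem_of_mem_erase hj)
  · intro k hk hks j hj
    rw [expire_sellers, Finset.mem_erase] at hks hj
    by_cases hki : k = i
    · subst hki; exact lt_of_le_of_ne (hmin j hj.2) (Ne.symm hj.1)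
    · exact h.expired_lt k hk (fun q => hks ⟨hki, q⟩) j hj.2
  · rw [expire_partner, expire_value]; exact h.partner_spec
  · rw [expire_partner]; exact h.partner_inj
  · rw [expire_partner, expire_value]; exact h.value_none
  · have key : ∀ e ∈ σ.matching, ((e.1 : ℕ) < a ∧ e.1 ∉ σ.sellers.erase i) ∧
        σ.partner e.1 = some e.2 ∧ σ.status e.1 = some .seller ∧ σ.status e.2 = some .buyer ∧
        e.1 < i := by
      intro e he
      obtain ⟨⟨h1, h2⟩, h3, h4, h5⟩ := h.matching_spec e he
      exact ⟨⟨h1, fun q => h2 (Finset.mem_of_mem_erase q)⟩, h3, h4, h5, h.expired_lt _ h1 h2 i hi⟩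
    -- If `i` is itself the buyer of a finalized pair, its role was fixed then and its coin is
    -- ignored.
    have key2 : ∀ e ∈ σ.matching, e.2 = i → σ.role c i = .buyer := by
      intro e he q
      obtain ⟨-, -, -, h5, -⟩ := key e he
      rw [q] at h5
      simp [State.role, h5]
    rw [expire_sellers, expire_partner]
    rcases hp : σ.partner i with _ | l
    · obtain ⟨hs, -, hm⟩ := expire_none (c := c) hp
      rw [hs, hm]
      intro e he
      obtain ⟨h1, h3, h4, h5, h6⟩ := key e he
      refine ⟨h1, h3, by rw [Function.update_of_ne h6.ne, h4], ?_⟩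
      by_cases q : e.2 = i
      · rw [q, Function.update_self, key2 e he q]
      · rw [Function.update_of_ne q, h5]
    · have hil := (h.partner_spec i l hp).1
      have old : ∀ r r', σ.role c i = r → ∀ e ∈ σ.matching,
          ((e.1 : ℕ) < a ∧ e.1 ∉ σ.sellers.erase i) ∧ σ.partner e.1 = some e.2 ∧
          Function.update (Function.update σ.status i (some r)) l (some r') e.1 = some .seller ∧
          Function.update (Function.update σ.status i (some r)) l (some r') e.2 = some .buyer := by
        intro r r' hr e he
        obtain ⟨h1, h3, h4, h5, h6⟩ := key e he
        refine ⟨h1, h3, ?_, ?_⟩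
        · rw [Function.update_of_ne (h6.trans hil).ne, Function.update_of_ne h6.ne, h4]
        · have : e.2 ≠ l := fun q => h6.ne (h.partner_inj _ _ l (q ▸ h3) hp)
          rw [Function.update_of_ne this]
          by_cases q : e.2 = i
          · rw [q, Function.update_self, ← hr, key2 e he q]
          · rw [Function.update_of_ne q, h5]
      rcases hr : σ.role c i with _ | _
      · obtain ⟨hs, -, hm⟩ := expire_seller hp hr
        rw [hs, hm]
        intro e he
        rcases Finset.mem_insert.1 he with rfl | he
        · refine ⟨⟨h.sellers_lt i hi, by simp⟩, hp, ?_, by simp⟩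
          simp [Function.update_of_ne hil.ne]
        · exact old _ _ hr e he
      · obtain ⟨hs, -, hm⟩ := expire_buyer hp hr
        rw [hs, hm]
        exact old _ _ hr

/-! ### Coupling of runs with opposite coins -/

/-- The runs with opposite coins: tentative matchings agree, roles are opposite, and every tentative
pair whose seller has left the market is finalized in exactly one of the two runs. -/
structure Coupled (w : Fin n → Fin n → ℝ) (a : ℕ) (σ σ' : State n) : Prop where
  sellers : σ'.sellers = σ.sellers
  partner : σ'.partner = σ.partner
  value : σ'.value = σ.value
  status : ∀ i, σ'.status i = (σ.status i).map Role.flip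
  p_add : σ.p + σ'.p = ∑ i ∈ σ.expired a, σ.value i
  weight_add : ∑ e ∈ σ.matching, w e.1 e.2 + ∑ e ∈ σ'.matching, w e.1 e.2 =
    ∑ i ∈ σ.expired a, (σ.partner i).elim 0 (w i)

variable {w : Fin n → Fin n → ℝ}

theorem Coupled.init : Coupled w 0 (State.init n) (State.init n) := by
  constructor <;> simp [State.init, State.expired]

theorem expired_arrive (ha : a < n) : (σ.arrive ⟨a, ha⟩).expired (a + 1) = σ.expired a := by
  ext i
  have hs : (σ.arrive ⟨a, ha⟩).sellers = insert ⟨a, ha⟩ σ.sellers := rfl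
  simp only [State.mem_expired, hs, Finset.mem_insert, not_or, Fin.ext_iff]
  constructor
  · rintro ⟨h1, h2, h3⟩; exact ⟨by omega, h3⟩
  · rintro ⟨h1, h3⟩; exact ⟨by omega, by omega, h3⟩

theorem expired_expire (c : Fin n → Bool) {i : Fin n} (hi : i ∈ σ.sellers) (hia : (i : ℕ) < a) :
    (σ.expire c i).expired a = insert i (σ.expired a) := by
  ext j
  simp only [State.mem_expired, expire_sellers, Finset.mem_insert, Finset.mem_erase]
  by_cases hj : j = i
  · subst hj; simp [hia]
  · simp [hj]

theorem Coupled.arrive (h : Coupled w a σ σ') (hv : Valid d W a b σ) (ha : a < n) :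
    Coupled w (a + 1) (σ.arrive ⟨a, ha⟩) (σ'.arrive ⟨a, ha⟩) := by
  refine ⟨?_, ?_, ?_, ?_, ?_, ?_⟩
  · show insert _ _ = insert _ _
    rw [h.sellers]
  · show Function.update _ _ _ = Function.update _ _ _
    rw [h.partner]
  · show Function.update _ _ _ = Function.update _ _ _
    rw [h.value]
  · intro i
    show Function.update σ'.status _ _ _ = Option.map _ (Function.update σ.status _ _ _)
    by_cases hi : i = ⟨a, ha⟩
    · subst hi; simp
    · rw [Function.update_of_ne hi, Function.update_of_ne hi, h.status]
  · rw [expired_arrive, hv.arrive_value]; exact h.p_add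
  · rw [expired_arrive, hv.arrive_partner]; exact h.weight_add

theorem Coupled.symm_role (h : Coupled w a σ σ') (c : Fin n → Bool) (i : Fin n) :
    σ'.role (fun j => !c j) i = (σ.role c i).flip := by
  unfold State.role
  rw [h.status]
  rcases σ.status i with _ | r
  · cases h : c i <;> simp [h, Role.flip]
  · rfl

/-- The roles of `i` are opposite, so exactly one run finalizes its tentative pair. Validity of both
states shows that the pair is new, so the insertion really adds its weight. -/
theorem Coupled.expire (h : Coupled w a σ σ') (hv : Valid d W a b σ) (hv' : Valid d W a b σ')
    (c : Fin n → Bool) {i : Fin n} (hi : i ∈ σ.sellers) :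
    Coupled w a (σ.expire c i) (σ'.expire (fun j => !c j) i) := by
  have hia := hv.sellers_lt i hi
  have hie : i ∉ σ.expired a := by simp [State.mem_expired, hi]
  have hr' := h.symm_role c i
  have hnm : ∀ l, (i, l) ∉ σ.matching := fun l q => (hv.matching_spec _ q).1.2 hi
  have hnm' : ∀ l, (i, l) ∉ σ'.matching := fun l q =>
    (hv'.matching_spec _ q).1.2 (h.sellers ▸ hi)
  have hupd : ∀ (f f' : Fin n → Option Role) (j : Fin n) (r : Role),
      (∀ k, f' k = (f k).map Role.flip) → ∀ k, Function.update f' j (some r.flip) k =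
        (Function.update f j (some r) k).map Role.flip := by
    intro f f' j r hf k
    by_cases hk : k = j
    · subst hk; simp
    · rw [Function.update_of_ne hk, Function.update_of_ne hk, hf]
  suffices hmain : (∀ k, (σ'.expire (fun j => !c j) i).status k =
        ((σ.expire c i).status k).map Role.flip) ∧
      (σ.expire c i).p + (σ'.expire (fun j => !c j) i).p = σ.value i + (σ.p + σ'.p) ∧
      ∑ e ∈ (σ.expire c i).matching, w e.1 e.2 +
        ∑ e ∈ (σ'.expire (fun j => !c j) i).matching, w e.1 e.2 =
        (σ.partner i).elim 0 (w i) +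
          (∑ e ∈ σ.matching, w e.1 e.2 + ∑ e ∈ σ'.matching, w e.1 e.2) by
    refine ⟨by simp [h.sellers], by simp [h.partner], by simp [h.value], hmain.1, ?_, ?_⟩
    · rw [expired_expire c hi hia, Finset.sum_insert hie, expire_value, ← h.p_add, hmain.2.1]
    · rw [expired_expire c hi hia, Finset.sum_insert hie, expire_partner, ← h.weight_add,
        hmain.2.2]
  rcases hp : σ.partner i with _ | l
  · have hp' : σ'.partner i = none := by rw [h.partner, hp]
    obtain ⟨s1, s2, s3⟩ := expire_none (c := c) hp
    obtain ⟨t1, t2, t3⟩ := expire_none (c := fun j => !c j) hp'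
    rw [s1, s2, s3, t1, t2, t3, hr', hv.value_none i hp]
    exact ⟨hupd _ _ _ _ h.status, by simp, by simp⟩
  · have hp' : σ'.partner i = some l := by rw [h.partner, hp]
    rcases hr : σ.role c i with _ | _
    · rw [hr] at hr'
      obtain ⟨s1, s2, s3⟩ := expire_seller hp hr
      obtain ⟨t1, t2, t3⟩ := expire_buyer hp' hr'
      rw [s1, s2, s3, t1, t2, t3, Finset.sum_insert (hnm l)]
      exact ⟨hupd _ _ _ .buyer (hupd _ _ _ .seller h.status), by ring, by simp; ring⟩
    · rw [hr] at hr'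
      obtain ⟨s1, s2, s3⟩ := expire_buyer hp hr
      obtain ⟨t1, t2, t3⟩ := expire_seller hp' hr'
      rw [s1, s2, s3, t1, t2, t3, Finset.sum_insert (hnm' l), h.value]
      exact ⟨hupd _ _ _ .seller (hupd _ _ _ .buyer h.status), by ring, by simp; ring⟩

/-- The list is sorted and precedes all remaining sellers, so each departing node is the oldest one
present, as `Valid.expire` requires. Coupling and validity go through one induction because each
coupling step uses validity of both states. -/
theorem foldl_expire (c : Fin n → Bool) : ∀ (L : List (Fin n)) (σ σ' : State n),
    Coupled w a σ σ' → Valid d W a b σ → Valid d W a b σ' → L.Pairwise (· < ·) →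
    (∀ i ∈ L, i ∈ σ.sellers) → (∀ j ∈ σ.sellers, j ∉ L → ∀ i ∈ L, i < j) →
    let τ := L.foldl (State.expire c) σ
    let τ' := L.foldl (State.expire fun j => !c j) σ'
    Coupled w a τ τ' ∧ Valid d W a b τ ∧ Valid d W a b τ' ∧
      (∀ j, j ∈ τ.sellers ↔ j ∈ σ.sellers ∧ j ∉ L) ∧ τ.value = σ.value := by
  intro L
  induction L with
  | nil => intro σ σ' h hv hv' _ _ _; simp [h, hv, hv']
  | cons i L ih =>
    intro σ σ' h hv hv' hL hs hlt
    rw [List.pairwise_cons] at hL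
    have hi := hs i (by simp)
    have hmin : ∀ j ∈ σ.sellers, i ≤ j := by
      intro j hj
      by_cases hjL : j ∈ i :: L
      · rcases List.mem_cons.1 hjL with rfl | hjL
        · exact le_rfl
        · exact (hL.1 j hjL).le
      · exact (hlt j hj hjL i (by simp)).le
    obtain ⟨r1, r2, r3, r4, r5⟩ := ih (σ.expire c i) (σ'.expire (fun j => !c j) i)
      (h.expire hv hv' c hi) (hv.expire c hi hmin)
      (hv'.expire _ (h.sellers ▸ hi) (h.sellers ▸ hmin)) hL.2
      (by
        intro j hj
        rw [expire_sellers, Finset.mem_erase]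
        exact ⟨(hL.1 j hj).ne', hs j (by simp [hj])⟩)
      (by
        intro j hj hjL k hk
        rw [expire_sellers, Finset.mem_erase] at hj
        exact hlt j hj.2 (by simp [hj.1, hjL]) k (by simp [hk]))
    refine ⟨r1, r2, r3, ?_, ?_⟩
    · intro j
      rw [List.foldl_cons, r4, expire_sellers, Finset.mem_erase, List.mem_cons, not_or]
      tauto
    · rw [List.foldl_cons, r5, expire_value]

theorem expireAll_spec (hd : Monotone d) (c : Fin n → Bool) (t : ℕ) (h : Coupled w a σ σ')
    (hv : Valid d W a b σ) (hv' : Valid d W a b σ')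
    (hs : ∀ i, i ∈ σ.sellers ↔ (i : ℕ) < a ∧ t ≤ d i) (hta : ∀ i : Fin n, d i = t → (i : ℕ) < a) :
    let τ := σ.expireAll d c t
    let τ' := σ'.expireAll d (fun j => !c j) t
    Coupled w a τ τ' ∧ Valid d W a b τ ∧ Valid d W a b τ' ∧
      (∀ j, j ∈ τ.sellers ↔ (j : ℕ) < a ∧ t < d j) ∧ τ.value = σ.value := by
  have := foldl_expire c ((List.finRange n).filter fun i => d i = t) σ σ' h hv hv'
    ((List.pairwise_lt_finRange n).filter _)
    (by
      intro i hi
      have hi : d i = t := by simpa using hi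
      exact (hs i).2 ⟨hta i hi, hi.ge⟩)
    (by
      intro j hj hjL i hi
      have hi : d i = t := by simpa using hi
      have hjL : d j ≠ t := by simpa using hjL
      have := ((hs j).1 hj).2
      -- Monotone deadlines enter here: a seller that stays has a strictly later deadline, hence
      -- arrived later.
      by_contra hij
      have := hd (not_lt.1 hij)
      omega)
  obtain ⟨r1, r2, r3, r4, r5⟩ := this
  refine ⟨r1, r2, r3, ?_, r5⟩
  intro j
  show j ∈ (List.foldl (State.expire c) σ _).sellers ↔ _
  rw [r4, hs]
  simp
  omega

/-! ### The greedy assignment -/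

/-- One assignment by the greedy rule, for weights that vanish on the new node itself. -/
theorem assign_spec {sel : Finset (Fin n) → (Fin n → ℝ) → Fin n} (hsel : IsArgmaxRule sel)
    (hW0 : ∀ i, W i i = 0) (t : Fin n) (h : Coupled w (t + 1) σ σ')
    (hv : Valid d W (t + 1) t σ) (hv' : Valid d W (t + 1) t σ')
    (hs : ∀ i, i ∈ σ.sellers ↔ (i : ℕ) < t + 1 ∧ (t : ℕ) < d i) (ht : (t : ℕ) < d t) :
    let τ := σ.assign sel (W t) t
    let τ' := σ'.assign sel (W t) t
    Coupled w (t + 1) τ τ' ∧ Valid d W (t + 1) (t + 1) τ ∧ Valid d W (t + 1) (t + 1) τ' ∧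
      τ.sellers = σ.sellers ∧ (∀ j, σ.value j ≤ τ.value j) ∧
      ∀ i ∈ σ.sellers, W t i - σ.value i ≤ ∑ j, τ.value j - ∑ j, σ.value j := by
  have hvt : ∀ {σ}, Valid d W (t + 1) t σ → σ.value t = 0 := by
    intro σ hv
    apply hv.value_none
    rcases hp : σ.partner t with _ | l
    · rfl
    · have := hv.partner_spec t l hp
      have h1 : (t : ℕ) < l := this.1
      omega
  have htm : t ∈ σ.sellers := (hs t).2 ⟨by omega, ht⟩
  set f : Fin n → ℝ := fun j => W t j - σ.value j with hf
  obtain ⟨hj1, hj2⟩ := hsel σ.sellers f ⟨t, htm⟩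
  set j := sel σ.sellers f with hj
  have hmono : ∀ {σ : State n}, Valid d W (t + 1) t σ → Valid d W (t + 1) (t + 1) σ := by
    intro σ hv
    refine ⟨le_rfl, hv.sellers_lt, hv.expired_lt, ?_, hv.partner_inj, hv.value_none,
      hv.matching_spec⟩
    intro i l hp
    obtain ⟨h1, h2, h3⟩ := hv.partner_spec i l hp
    exact ⟨h1, by omega, h3⟩
  have e' : (sel σ'.sellers fun j => W t j - σ'.value j) = j := by rw [h.sellers, h.value]
  by_cases hjt : j = t
  · have e1 : σ.assign sel (W t) t = σ := by
      unfold State.assign; exact if_pos hjt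
    have e2 : σ'.assign sel (W t) t = σ' := by
      unfold State.assign; dsimp only; rw [e']; exact if_pos hjt
    intro τ τ'
    simp only [τ, τ', e1, e2]
    refine ⟨h, hmono hv, hmono hv', trivial, fun _ => le_rfl, ?_⟩
    intro i hi
    have := hj2 i hi
    rw [hjt] at this
    simp only [hf, hW0, hvt hv] at this
    simpa using this
  · have e1 : σ.assign sel (W t) t = { σ with
        partner := Function.update σ.partner j (some t)
        value := Function.update σ.value j (max (σ.value j) (W t j)) } := by
      unfold State.assign; exact if_neg hjt
    have e2 : σ'.assign sel (W t) t = { σ' with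
        partner := Function.update σ'.partner j (some t)
        value := Function.update σ'.value j (max (σ'.value j) (W t j)) } := by
      unfold State.assign; dsimp only; rw [e']; exact if_neg hjt
    -- The new node's own seller copy competes with increment 0, so the best increment is
    -- nonnegative and the `max` in the update is the new weight.
    have hge : σ.value j ≤ W t j := by
      have := hj2 t htm
      simp only [hf, hW0, hvt hv] at this
      linarith
    have hlt : j < t := by
      have := ((hs j).1 hj1).1
      have h2 : (j : ℕ) ≠ t := fun q => hjt (Fin.ext q)
      exact Fin.lt_def.2 (by omega)
    have hval : ∀ {σ : State n}, j ∈ σ.sellers → σ.value j ≤ W t j →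
        Valid d W (t + 1) t σ → Valid d W (t + 1) (t + 1) { σ with
        partner := Function.update σ.partner j (some t)
        value := Function.update σ.value j (max (σ.value j) (W t j)) } := by
      intro σ hjs hge hv
      have hnt : ∀ i, σ.partner i ≠ some t := fun i q => by
        have := (hv.partner_spec i t q).2.1; omega
      refine ⟨le_rfl, hv.sellers_lt, hv.expired_lt, ?_, ?_, ?_, ?_⟩ <;> dsimp only
      · intro i l hp
        by_cases hi : i = j
        · subst hi
          rw [Function.update_self] at hp ⊢
          obtain rfl : t = l := by simpa using hp
          exact ⟨hlt, by omega, ((hs _).1 hj1).2, max_eq_right hge⟩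
        · rw [Function.update_of_ne hi] at hp ⊢
          obtain ⟨h1, h2, h3⟩ := hv.partner_spec i l hp
          exact ⟨h1, by omega, h3⟩
      · intro i i' l hp hp'
        by_cases hi : i = j <;> by_cases hi' : i' = j
        · rw [hi, hi']
        · subst hi
          rw [Function.update_self] at hp
          rw [Function.update_of_ne hi', ← hp] at hp'
          exact (hnt _ hp').elim
        · subst hi'
          rw [Function.update_self] at hp'
          rw [Function.update_of_ne hi, ← hp'] at hp
          exact (hnt _ hp).elim
        · rw [Function.update_of_ne hi] at hp
          rw [Function.update_of_ne hi'] at hp'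
          exact hv.partner_inj _ _ _ hp hp'
      · intro i hp
        by_cases hi : i = j
        · subst hi; simp at hp
        · rw [Function.update_of_ne hi] at hp ⊢
          exact hv.value_none i hp
      · intro e he
        obtain ⟨h1, h2, h3⟩ := hv.matching_spec e he
        have : e.1 ≠ j := fun q => h1.2 (q ▸ hjs)
        rw [Function.update_of_ne this]
        exact ⟨h1, h2, h3⟩
    -- Only a seller still in the market is changed, so both sums over expired sellers are
    -- untouched.
    have hne : ∀ i ∈ σ.expired (t + 1), i ≠ j := fun i hi q =>
      (State.mem_expired.1 hi).2 (q ▸ hj1)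
    intro τ τ'
    simp only [τ, τ', e1, e2]
    refine ⟨⟨h.sellers, by simp [h.partner], by simp [h.value], h.status, ?_, ?_⟩,
      hval hj1 hge hv, hval (h.sellers ▸ hj1) (h.value ▸ hge) hv', trivial, ?_, ?_⟩
    · show σ.p + σ'.p = ∑ i ∈ σ.expired (t + 1), Function.update σ.value _ _ i
      rw [h.p_add]
      exact Finset.sum_congr rfl fun i hi => by rw [Function.update_of_ne (hne i hi)]
    · show _ = ∑ i ∈ σ.expired (t + 1), (Function.update σ.partner _ _ i).elim 0 (w i)
      refine h.weight_add.trans ?_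
      exact Finset.sum_congr rfl fun i hi => by rw [Function.update_of_ne (hne i hi)]
    · intro i
      by_cases hi : i = j
      · rw [hi, Function.update_self]; exact le_max_left _ _
      · rw [Function.update_of_ne hi]
    · intro i hi
      rw [max_eq_right hge, Finset.sum_update_of_mem (Finset.mem_univ j),
        ← Finset.add_sum_erase Finset.univ σ.value (Finset.mem_univ j), Finset.sdiff_singleton_eq_erase]
      have := hj2 i hi
      simp only [hf] at this
      linarith

end FPG

/-! ### Concentration of squares of random signed sums -/

namespace FPG

/-- The random sum `∑ ± u j`. -/
def signSum {D : ℕ} (u : Fin D → ℝ) (r : Fin D → Bool) : ℝ :=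
  ∑ j, if r j then u j else -u j

theorem sum_bool_fun_succ {D : ℕ} (f : (Fin (D + 1) → Bool) → ℝ) :
    ∑ r, f r = ∑ r : Fin D → Bool, (f (Fin.cons true r) + f (Fin.cons false r)) := by
  rw [← (Fin.consEquiv fun _ : Fin (D + 1) => Bool).sum_comp, Fintype.sum_prod_type]
  rw [Fintype.sum_bool, ← Finset.sum_add_distrib]
  rfl

theorem signSum_cons_true {D : ℕ} (u : Fin (D + 1) → ℝ) (r : Fin D → Bool) :
    signSum u (Fin.cons true r) = u 0 + signSum (fun j => u j.succ) r := by
  simp [signSum, Fin.sum_univ_succ]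

theorem signSum_cons_false {D : ℕ} (u : Fin (D + 1) → ℝ) (r : Fin D → Bool) :
    signSum u (Fin.cons false r) = -u 0 + signSum (fun j => u j.succ) r := by
  simp [signSum, Fin.sum_univ_succ]

theorem sum_signSum_sq {D : ℕ} (u : Fin D → ℝ) :
    ∑ r, signSum u r ^ 2 = 2 ^ D * ∑ j, u j ^ 2 := by
  induction D with
  | zero => simp [signSum]
  | succ D ih =>
    rw [sum_bool_fun_succ, Fin.sum_univ_succ]
    simp only [signSum_cons_true, signSum_cons_false]
    have : ∀ r : Fin D → Bool,
        (u 0 + signSum (fun j => u j.succ) r) ^ 2 +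
        (-u 0 + signSum (fun j => u j.succ) r) ^ 2 =
        2 * u 0 ^ 2 + 2 * signSum (fun j => u j.succ) r ^ 2 := by
      intro r; ring
    simp only [this, Finset.sum_add_distrib, ← Finset.mul_sum, ih]
    simp
    ring

theorem sum_signSum_pow_four {D : ℕ} (u : Fin D → ℝ) :
    ∑ r, signSum u r ^ 4 ≤ 2 ^ D * (3 * (∑ j, u j ^ 2) ^ 2) := by
  induction D with
  | zero => simp [signSum]
  | succ D ih =>
    rw [sum_bool_fun_succ, Fin.sum_univ_succ]
    simp only [signSum_cons_true, signSum_cons_false]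
    have : ∀ r : Fin D → Bool,
        (u 0 + signSum (fun j => u j.succ) r) ^ 4 +
        (-u 0 + signSum (fun j => u j.succ) r) ^ 4 =
        2 * u 0 ^ 4 + 12 * u 0 ^ 2 * signSum (fun j => u j.succ) r ^ 2 +
          2 * signSum (fun j => u j.succ) r ^ 4 := by
      intro r; ring
    simp only [this, Finset.sum_add_distrib, ← Finset.mul_sum, sum_signSum_sq]
    have h := ih fun j => u j.succ
    have h2 : (0 : ℝ) ≤ 2 ^ D * u 0 ^ 4 := by positivity
    simp only [Finset.sum_const, Finset.card_univ, Fintype.card_pi, Fintype.card_bool,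
      Finset.prod_const, Fintype.card_fin, nsmul_eq_mul, Nat.cast_pow, Nat.cast_ofNat]
    rw [pow_succ (2 : ℝ) D]
    nlinarith

/-- The moment generating function of the square of a random signed sum is at most that of the
square of a Gaussian variable. -/
theorem sum_exp_signSum_sq_le {D : ℕ} (u : Fin D → ℝ) (t : ℝ) (ht : 0 ≤ t)
    (h : 2 * t * ∑ j, u j ^ 2 < 1) :
    ∑ r, Real.exp (t * signSum u r ^ 2) ≤ 2 ^ D * (Real.sqrt (1 - 2 * t * ∑ j, u j ^ 2))⁻¹ := by
  induction D generalizing t with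
  | zero => simp [signSum]
  | succ D ih =>
    rw [sum_bool_fun_succ]
    rw [Fin.sum_univ_succ] at h ⊢
    simp only [signSum_cons_true, signSum_cons_false]
    set A := ∑ j : Fin D, u j.succ ^ 2 with hA
    have hA0 : 0 ≤ A := by positivity
    set b := 2 * t * u 0 ^ 2 with hb
    have hb0 : 0 ≤ b := by positivity
    have hq0 : 0 ≤ 2 * t * A := by positivity
    have hlt : b + 2 * t * A < 1 := by rw [hb]; linarith
    have hterm : ∀ r : Fin D → Bool,
        Real.exp (t * (u 0 + signSum (fun j => u j.succ) r) ^ 2) +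
        Real.exp (t * (-u 0 + signSum (fun j => u j.succ) r) ^ 2) ≤
        2 * Real.exp (b / 2) *
          Real.exp (t * (1 + b) * signSum (fun j => u j.succ) r ^ 2) := by
      intro r
      set z := signSum (fun j => u j.succ) r
      have h1 := Real.cosh_le_exp_half_sq (2 * t * u 0 * z)
      rw [Real.cosh_eq] at h1
      have e1 : t * (u 0 + z) ^ 2 =
          (b / 2 + t * z ^ 2) + 2 * t * u 0 * z := by simp [hb]; ring
      have e2 : t * (-u 0 + z) ^ 2 =
          (b / 2 + t * z ^ 2) + -(2 * t * u 0 * z) := by simp [hb]; ring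
      have e3 : t * (1 + b) * z ^ 2 = t * z ^ 2 + (2 * t * u 0 * z) ^ 2 / 2 := by
        rw [hb]; ring
      rw [e1, e2, e3, Real.exp_add, Real.exp_add (b / 2 + t * z ^ 2), Real.exp_add (t * z ^ 2),
        Real.exp_add (b / 2)]
      have : 0 < Real.exp (b / 2) * Real.exp (t * z ^ 2) := by positivity
      nlinarith
    refine (Finset.sum_le_sum fun r _ => hterm r).trans ?_
    rw [← Finset.mul_sum]
    have hb1 : b < 1 := by linarith
    have hkey : (1 + b) * (2 * t * A) * (1 - b) ≤ 2 * t * A := by nlinarith [mul_nonneg hq0 (sq_nonneg b)]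
    have hlt2 : 2 * (t * (1 + b)) * A < 1 := by
      by_contra hc
      push Not at hc
      nlinarith
    have h2 := ih (fun j => u j.succ) (t * (1 + b)) (by positivity) hlt2
    rw [← hA] at h2
    have hexp : Real.exp b * (1 - b) ≤ 1 := by
      have := Real.add_one_le_exp (-b)
      have h3 : Real.exp b * Real.exp (-b) = 1 := by rw [← Real.exp_add]; simp
      have := Real.exp_pos b
      nlinarith
    -- After squaring, this follows from `exp b * (1 - b) ≤ 1` and `(1 + b) * (1 - b) ≤ 1`.
    have hfin : Real.exp (b / 2) * (Real.sqrt (1 - 2 * (t * (1 + b)) * A))⁻¹ ≤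
        (Real.sqrt (1 - 2 * t * (u 0 ^ 2 + A)))⁻¹ := by
      have p1 : 0 < 1 - 2 * (t * (1 + b)) * A := by linarith
      have p2 : 0 < 1 - 2 * t * (u 0 ^ 2 + A) := by linarith
      rw [← div_eq_mul_inv, div_le_iff₀ (Real.sqrt_pos.2 p1), ← div_eq_inv_mul,
        le_div_iff₀ (Real.sqrt_pos.2 p2)]
      have e : Real.exp (b / 2) = Real.sqrt (Real.exp b) := by
        rw [Real.exp_half]
      rw [e, ← Real.sqrt_mul (by positivity)]
      apply Real.sqrt_le_sqrt
      have e5 : 1 - 2 * t * (u 0 ^ 2 + A) = 1 - b - 2 * t * A := by rw [hb]; ring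
      rw [e5]
      have h6 : Real.exp b * (1 - b - 2 * t * A) * (1 - b) ≤
          (1 - 2 * (t * (1 + b)) * A) * (1 - b) := by
        nlinarith
      exact le_of_mul_le_mul_right h6 (by linarith)
    calc 2 * Real.exp (b / 2) *
          ∑ r, Real.exp (t * (1 + b) * signSum (fun j => u j.succ) r ^ 2)
        ≤ 2 * Real.exp (b / 2) * (2 ^ D * (Real.sqrt (1 - 2 * (t * (1 + b)) * A))⁻¹) := by
          gcongr
      _ = 2 ^ (D + 1) * (Real.exp (b / 2) * (Real.sqrt (1 - 2 * (t * (1 + b)) * A))⁻¹) := by ring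
      _ ≤ _ := by gcongr

/-- Uses `(1 - 2q)(1 + 2q + 8q²) = 1 + 4q²(1 - 4q) ≥ 1` for `0 ≤ q ≤ 1/4`, which is where the
threshold on `t` comes from. -/
theorem sum_exp_signSum_sq_le_exp {D : ℕ} (u : Fin D → ℝ) (t : ℝ) (ht : 0 ≤ t)
    (h : 4 * (t * ∑ j, u j ^ 2) ≤ 1) :
    ∑ r, Real.exp (t * signSum u r ^ 2) ≤
      2 ^ D * Real.exp (t * ∑ j, u j ^ 2 + 4 * (t * ∑ j, u j ^ 2) ^ 2) := by
  set q := t * ∑ j, u j ^ 2 with hq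
  have hq0 : 0 ≤ q := by positivity
  have e : 2 * t * ∑ j, u j ^ 2 = 2 * q := by rw [hq]; ring
  refine (sum_exp_signSum_sq_le u t ht (by rw [e]; linarith)).trans ?_
  rw [e]
  gcongr
  have p : 0 < 1 - 2 * q := by linarith
  rw [inv_le_comm₀ (Real.sqrt_pos.2 p) (Real.exp_pos _), ← Real.exp_neg]
  apply Real.le_sqrt_of_sq_le
  rw [← Real.exp_nat_mul]
  have h1 := Real.add_one_le_exp (2 * q + 8 * q ^ 2)
  have h2 : ((2 : ℕ) : ℝ) * -(q + 4 * q ^ 2) = -(2 * q + 8 * q ^ 2) := by push_cast; ring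
  rw [h2, Real.exp_neg, inv_le_comm₀ (Real.exp_pos _) p]
  refine le_trans ?_ h1
  rw [inv_le_iff_one_le_mul₀ p]
  nlinarith [mul_nonneg (sq_nonneg q) (by linarith : (0 : ℝ) ≤ 1 - 4 * q)]

/-- For the lower tail two moments suffice, through `exp (-y) ≤ 1 - y + y²/2` for `y ≥ 0`. The
fourth moment gives the quadratic coefficient 3/2, relaxed to 4 to match the upper tail. -/
theorem sum_exp_neg_signSum_sq_le_exp {D : ℕ} (u : Fin D → ℝ) (t : ℝ) (ht : 0 ≤ t) :
    ∑ r, Real.exp (-(t * signSum u r ^ 2)) ≤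
      2 ^ D * Real.exp (-(t * ∑ j, u j ^ 2) + 4 * (t * ∑ j, u j ^ 2) ^ 2) := by
  have h1 : ∀ y : ℝ, 0 ≤ y → Real.exp (-y) ≤ 1 - y + y ^ 2 / 2 := by
    intro y hy
    have h3 := Real.quadratic_le_exp_of_nonneg hy
    have h4 : Real.exp y * Real.exp (-y) = 1 := by rw [← Real.exp_add]; simp
    have h5 : 0 < 1 - y + y ^ 2 / 2 := by nlinarith [sq_nonneg (y - 1)]
    have h6 : 1 ≤ Real.exp y * (1 - y + y ^ 2 / 2) := by
      have : 1 ≤ (1 + y + y ^ 2 / 2) * (1 - y + y ^ 2 / 2) := by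
        nlinarith [sq_nonneg (y ^ 2)]
      nlinarith
    have := Real.exp_pos y
    nlinarith
  have h2 : ∑ r, Real.exp (-(t * signSum u r ^ 2)) ≤
      ∑ r, (1 - t * signSum u r ^ 2 + t ^ 2 / 2 * signSum u r ^ 4) := by
    refine Finset.sum_le_sum fun r _ => (h1 _ (by positivity)).trans (le_of_eq (by ring))
  refine h2.trans ?_
  rw [Finset.sum_add_distrib, Finset.sum_sub_distrib, ← Finset.mul_sum, ← Finset.mul_sum,
    sum_signSum_sq]
  have h3 := mul_le_mul_of_nonneg_left (sum_signSum_pow_four u) (by positivity : 0 ≤ t ^ 2 / 2)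
  set A := ∑ j, u j ^ 2
  have h4 := Real.add_one_le_exp (-(t * A) + 4 * (t * A) ^ 2)
  have h5 : (0 : ℝ) < 2 ^ D := by positivity
  have h6 : ∑ r : Fin D → Bool, (1 : ℝ) = 2 ^ D := by simp
  rw [h6]
  have h7 := mul_le_mul_of_nonneg_left h4 h5.le
  have h8 : 0 ≤ 2 ^ D * (t * A) ^ 2 := by positivity
  nlinarith

/-- Markov's inequality for the exponential of a sum of independent copies. -/
theorem card_le_of_sum_exp {s : ℕ} {β : Type*} [Fintype β] (g : β → ℝ) (m K : ℝ)
    (h : ∑ r, Real.exp (g r) ≤ Fintype.card β * Real.exp m) :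
    ((Finset.univ.filter fun R : Fin s → β => K ≤ ∑ k, g (R k)).card : ℝ) ≤
      (Fintype.card β : ℝ) ^ s * Real.exp (s * m - K) := by
  have h1 : ∑ R : Fin s → β, Real.exp (∑ k, g (R k)) ≤
      (Fintype.card β : ℝ) ^ s * Real.exp (s * m) := by
    simp only [Real.exp_sum]
    rw [← Fintype.sum_pow (fun r => Real.exp (g r)) s, Real.exp_nat_mul, ← mul_pow]
    exact pow_le_pow_left₀ (Finset.sum_nonneg fun _ _ => (Real.exp_pos _).le) h s
  have h2 : ((Finset.univ.filter fun R : Fin s → β => K ≤ ∑ k, g (R k)).card : ℝ) * Real.exp K ≤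
      ∑ R : Fin s → β, Real.exp (∑ k, g (R k)) := by
    rw [← nsmul_eq_mul, ← Finset.sum_const]
    refine (Finset.sum_le_sum fun R hR => ?_).trans
      (Finset.sum_le_sum_of_subset_of_nonneg (Finset.filter_subset _ _)
        fun _ _ _ => (Real.exp_pos _).le)
    exact Real.exp_le_exp.2 (Finset.mem_filter.1 hR).2
  rw [Real.exp_sub, ← mul_div_assoc, le_div_iff₀ (Real.exp_pos _)]
  exact h2.trans h1

theorem card_upper_tail_le {s D : ℕ} (u : Fin D → ℝ) (hu : 0 < ∑ j, u j ^ 2) {η : ℝ}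
    (h0 : 0 < η) (h1 : η ≤ 1) :
    ((Finset.univ.filter fun R : Fin s → Fin D → Bool =>
      (1 + η) * (s * ∑ j, u j ^ 2) ≤ ∑ k, signSum u (R k) ^ 2).card : ℝ) ≤
      Fintype.card (Fin s → Fin D → Bool) * Real.exp (-(s * η ^ 2 / 16)) := by
  set A := ∑ j, u j ^ 2
  -- With this Chernoff parameter the exponent per row is `η/8 + η²/16 - (1 + η)η/8 = -η²/16`.
  have ht : 0 < η / (8 * A) := by positivity
  have hq : η / (8 * A) * A = η / 8 := by field_simp
  have := card_le_of_sum_exp (s := s) (fun r => η / (8 * A) * signSum u r ^ 2)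
    (η / 8 + 4 * (η / 8) ^ 2) (η / (8 * A) * ((1 + η) * (s * A))) (by
      have := sum_exp_signSum_sq_le_exp u _ ht.le (by rw [hq]; linarith)
      rw [hq] at this
      simpa using this)
  have e1 : (Fintype.card (Fin s → Fin D → Bool) : ℝ) =
    (Fintype.card (Fin D → Bool) : ℝ) ^ s := by simp
  rw [e1]
  refine le_trans (le_of_eq ?_) (this.trans (le_of_eq ?_))
  · congr 2
    ext R
    rw [Finset.mem_filter, Finset.mem_filter, ← Finset.mul_sum, mul_le_mul_iff_right₀ ht]
  · congr 2
    linear_combination (-s * (1 + η)) * hq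

theorem card_lower_tail_le {s D : ℕ} (u : Fin D → ℝ) (hu : 0 < ∑ j, u j ^ 2) {η : ℝ}
    (h0 : 0 < η) :
    ((Finset.univ.filter fun R : Fin s → Fin D → Bool =>
      ∑ k, signSum u (R k) ^ 2 ≤ (1 - η) * (s * ∑ j, u j ^ 2)).card : ℝ) ≤
      Fintype.card (Fin s → Fin D → Bool) * Real.exp (-(s * η ^ 2 / 16)) := by
  set A := ∑ j, u j ^ 2
  have ht : 0 < η / (8 * A) := by positivity
  have hq : η / (8 * A) * A = η / 8 := by field_simp
  have := card_le_of_sum_exp (s := s) (fun r => -(η / (8 * A) * signSum u r ^ 2))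
    (-(η / 8) + 4 * (η / 8) ^ 2) (-(η / (8 * A) * ((1 - η) * (s * A)))) (by
      have := sum_exp_neg_signSum_sq_le_exp u _ ht.le
      rw [hq] at this
      simpa using this)
  have e1 : (Fintype.card (Fin s → Fin D → Bool) : ℝ) =
    (Fintype.card (Fin D → Bool) : ℝ) ^ s := by simp
  rw [e1]
  refine le_trans (le_of_eq ?_) (this.trans (le_of_eq ?_))
  · congr 2
    ext R
    rw [Finset.mem_filter, Finset.mem_filter, Finset.sum_neg_distrib, neg_le_neg_iff,
      ← Finset.mul_sum, mul_le_mul_iff_right₀ ht]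
  · congr 2
    linear_combination (s * (1 - η)) * hq

end FPG

namespace FPG

variable {n s D : ℕ}

/-! ### The sketch -/

theorem norm_sketch_sub_sq (R : Fin s → Fin D → Bool) (a b : EuclideanSpace ℝ (Fin D)) :
    s * ‖sketch (sketchMatrix R) a - sketch (sketchMatrix R) b‖ ^ 2 =
      ∑ k, signSum (fun j => (a - b) j) (R k) ^ 2 := by
  rcases Nat.eq_zero_or_pos s with rfl | hs
  · simp
  have hs' : (0 : ℝ) < s := by exact_mod_cast hs
  rw [EuclideanSpace.norm_sq_eq, Finset.mul_sum]
  refine Finset.sum_congr rfl fun k _ => ?_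
  have : (sketch (sketchMatrix R) a - sketch (sketchMatrix R) b) k =
      1 / Real.sqrt s * signSum (fun j => (a - b) j) (R k) := by
    simp only [sketch, sketchMatrix, signSum, PiLp.sub_apply, Matrix.mulVec, dotProduct,
      Matrix.of_apply, ← Finset.sum_sub_distrib, Finset.mul_sum]
    refine Finset.sum_congr rfl fun j _ => ?_
    split <;> ring
  rw [this, Real.norm_eq_abs, sq_abs, mul_pow, div_pow, Real.sq_sqrt hs'.le]
  field_simp

/-- The sketch distorts the distance of `a` and `b` by a factor between `1 - η` and `1 + η`. -/
def Faithful (η : ℝ) (R : Fin s → Fin D → Bool) (a b : EuclideanSpace ℝ (Fin D)) : Prop :=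
  (1 - η) * ‖a - b‖ ≤ ‖sketch (sketchMatrix R) a - sketch (sketchMatrix R) b‖ ∧
    ‖sketch (sketchMatrix R) a - sketch (sketchMatrix R) b‖ ≤ (1 + η) * ‖a - b‖

open Classical in
theorem card_not_faithful_le (hs : 0 < s) {η : ℝ} (h0 : 0 < η) (h1 : η ≤ 1)
    (a b : EuclideanSpace ℝ (Fin D)) :
    ((Finset.univ.filter fun R : Fin s → Fin D → Bool => ¬ Faithful η R a b).card : ℝ) ≤
      Fintype.card (Fin s → Fin D → Bool) * (2 * Real.exp (-(s * η ^ 2 / 16))) := by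
  have hs' : (0 : ℝ) < s := by exact_mod_cast hs
  by_cases hab : a = b
  · subst hab
    have : ∀ R : Fin s → Fin D → Bool, Faithful η R a a := fun R => by simp [Faithful]
    simp only [this, not_true_eq_false, Finset.filter_false, Finset.card_empty, Nat.cast_zero]
    positivity
  have hA : ∑ j, ((a - b) j) ^ 2 = ‖a - b‖ ^ 2 := by
    rw [EuclideanSpace.norm_sq_eq]; simp
  have hn : 0 < ‖a - b‖ := norm_pos_iff.2 (sub_ne_zero.2 hab)
  have hA0 : 0 < ∑ j, ((a - b) j) ^ 2 := by rw [hA]; positivity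
  have hsub : (Finset.univ.filter fun R : Fin s → Fin D → Bool => ¬ Faithful η R a b) ⊆
      (Finset.univ.filter fun R : Fin s → Fin D → Bool =>
        (1 + η) * (s * ∑ j, ((a - b) j) ^ 2) ≤ ∑ k, signSum (fun j => (a - b) j) (R k) ^ 2) ∪
      (Finset.univ.filter fun R : Fin s → Fin D → Bool =>
        ∑ k, signSum (fun j => (a - b) j) (R k) ^ 2 ≤ (1 - η) * (s * ∑ j, ((a - b) j) ^ 2)) := by
    intro R hR
    rw [Finset.mem_filter] at hR
    rw [Finset.mem_union, Finset.mem_filter, Finset.mem_filter]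
    by_contra hc
    simp only [Finset.mem_univ, true_and] at hc
    push Not at hc
    rw [← norm_sketch_sub_sq, hA] at hc
    obtain ⟨c1, c2⟩ := hc
    apply hR.2
    set y := ‖sketch (sketchMatrix R) a - sketch (sketchMatrix R) b‖
    have c1' : y ^ 2 < (1 + η) * ‖a - b‖ ^ 2 := by
      refine lt_of_mul_lt_mul_left ?_ hs'.le; linarith
    have c2' : (1 - η) * ‖a - b‖ ^ 2 < y ^ 2 := by
      refine lt_of_mul_lt_mul_left ?_ hs'.le; linarith
    have hsq : 0 < ‖a - b‖ ^ 2 := by positivity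
    -- Bounds on squared lengths pass to lengths because `(1 - η)² ≤ 1 - η` and `1 + η ≤ (1 + η)²`.
    constructor
    · refine (pow_le_pow_iff_left₀ (mul_nonneg (sub_nonneg.2 h1) hn.le) (norm_nonneg _)
        two_ne_zero).1 ?_
      rw [mul_pow]
      nlinarith [mul_nonneg (mul_nonneg h0.le (sub_nonneg.2 h1)) hsq.le]
    · refine (pow_le_pow_iff_left₀ (norm_nonneg _) (by positivity) two_ne_zero).1 ?_
      rw [mul_pow]
      nlinarith [mul_nonneg (mul_nonneg h0.le (by linarith : 0 ≤ 1 + η)) hsq.le]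
  have h3 := (Nat.cast_le (α := ℝ)).2
    ((Finset.card_le_card hsub).trans (Finset.card_union_le _ _))
  rw [Nat.cast_add] at h3
  have h4 := card_upper_tail_le (s := s) (fun j => (a - b) j) hA0 h0 h1
  have h5 := card_lower_tail_le (s := s) (fun j => (a - b) j) hA0 h0
  linarith

open Classical in
/-- The Johnson–Lindenstrauss lemma for `n` points and random signs. -/
theorem le_signLaw_faithful {C ε δ : ℝ} (hC : 192 ≤ C) (hε : 0 < ε) (hε1 : ε < 1) (hδ : 0 < δ)
    (hδ1 : δ < 1) (x : Fin n → EuclideanSpace ℝ (Fin D)) :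
    ENNReal.ofReal (1 - δ) ≤ signLaw (sketchDim C ε δ n) D
      {R | ∀ i j : Fin n, i < j → Faithful (ε / 2) R (x j) (x i)} := by
  set s := sketchDim C ε δ n with hsd
  set G : Set (Fin s → Fin D → Bool) := {R | ∀ i j : Fin n, i < j → Faithful (ε / 2) R (x j) (x i)}
  set N : ℝ := (Fintype.card (Fin s → Fin D → Bool) : ℝ) with hN
  have hN0 : 0 < N := by rw [hN]; exact_mod_cast Fintype.card_pos
  suffices hcard : (1 - δ) * N ≤ (Fintype.card G : ℝ) by
    rw [signLaw, PMF.toMeasure_uniformOfFintype_apply _ (Set.toFinite _).measurableSet]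
    rw [← ENNReal.ofReal_natCast, ← ENNReal.ofReal_natCast, ← ENNReal.ofReal_div_of_pos hN0]
    exact ENNReal.ofReal_le_ofReal ((le_div_iff₀ hN0).2 hcard)
  have hG : (Fintype.card G : ℝ) =
      N - (Finset.univ.filter fun R : Fin s → Fin D → Bool => R ∉ G).card := by
    have := Finset.card_filter_add_card_filter_not (s := (Finset.univ : Finset (Fin s → Fin D → Bool)))
      (fun R => R ∈ G)
    rw [Finset.card_univ] at this
    rw [hN, ← this, Fintype.card_subtype]
    push_cast; ring
  rw [hG]
  suffices hbad : ((Finset.univ.filter fun R : Fin s → Fin D → Bool => R ∉ G).card : ℝ) ≤ δ * N by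
    linarith
  -- Below two points there are no pairs; the final estimate needs `2 / n ≤ 1`.
  rcases Nat.lt_or_ge n 2 with hn | hn
  · have : ∀ R : Fin s → Fin D → Bool, R ∈ G := by
      intro R i j hij
      have : (i : ℕ) < j := hij
      omega
    simp only [this, not_true_eq_false, Finset.filter_false, Finset.card_empty, Nat.cast_zero]
    positivity
  have hn' : (2 : ℝ) ≤ n := by exact_mod_cast hn
  have hnδ : 1 < n / δ := by rw [lt_div_iff₀ hδ]; linarith
  have hlog : 0 < Real.log (n / δ) := Real.log_pos hnδ
  have hsle : C * (ε ^ 2)⁻¹ * Real.log (n / δ) ≤ s := Nat.le_ceil _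
  have hs0 : (0 : ℝ) < s := lt_of_lt_of_le (by positivity) hsle
  have hs : 0 < s := by exact_mod_cast hs0
  -- Here `192 = 3 * 4 * 16`. The cube beats the `n²` pairs of the union bound, leaving `2δ³/n ≤ δ`.
  have hexp : Real.exp (-(s * (ε / 2) ^ 2 / 16)) ≤ (δ / n) ^ 3 := by
    have h1 : 3 * Real.log (n / δ) ≤ s * (ε / 2) ^ 2 / 16 := by
      have h2 : C * Real.log (n / δ) ≤ s * ε ^ 2 := by
        have := mul_le_mul_of_nonneg_right hsle (sq_nonneg ε)
        refine le_trans (le_of_eq ?_) this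
        field_simp
      nlinarith
    have h3 : (δ / n) ^ 3 = Real.exp (-(3 * Real.log (n / δ))) := by
      rw [Real.exp_neg, show (3 : ℝ) = ((3 : ℕ) : ℝ) by norm_num, Real.exp_nat_mul,
        Real.exp_log (by positivity), ← inv_pow, inv_div]
    rw [h3]
    exact Real.exp_le_exp.2 (by linarith)
  have hsub : (Finset.univ.filter fun R : Fin s → Fin D → Bool => R ∉ G) ⊆
      (Finset.univ : Finset (Fin n × Fin n)).biUnion fun e =>
        Finset.univ.filter fun R : Fin s → Fin D → Bool => ¬ Faithful (ε / 2) R (x e.2) (x e.1) := by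
    intro R hR
    rw [Finset.mem_filter] at hR
    have h1 : ¬ ∀ i j : Fin n, i < j → Faithful (ε / 2) R (x j) (x i) := hR.2
    push Not at h1
    obtain ⟨i, j, -, h2⟩ := h1
    rw [Finset.mem_biUnion]
    exact ⟨(i, j), Finset.mem_univ _, by simpa using h2⟩
  have h1 : ((Finset.univ.filter fun R : Fin s → Fin D → Bool => R ∉ G).card : ℝ) ≤
      ∑ e : Fin n × Fin n, ((Finset.univ.filter fun R : Fin s → Fin D → Bool =>
        ¬ Faithful (ε / 2) R (x e.2) (x e.1)).card : ℝ) := by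
    exact_mod_cast (Finset.card_le_card hsub).trans Finset.card_biUnion_le
  refine h1.trans ((Finset.sum_le_sum fun e _ => card_not_faithful_le hs (by linarith)
    (by linarith) (x e.2) (x e.1)).trans ?_)
  rw [Finset.sum_const, Finset.card_univ, Fintype.card_prod, Fintype.card_fin, nsmul_eq_mul, ← hN]
  push_cast
  calc (n : ℝ) * n * (N * (2 * Real.exp (-(s * (ε / 2) ^ 2 / 16))))
      ≤ n * n * (N * (2 * (δ / n) ^ 3)) := by gcongr
    _ = (2 / n * δ ^ 2) * (δ * N) := by field_simp
    _ ≤ 1 * (δ * N) := by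
        have : 2 / (n : ℝ) ≤ 1 := by rw [div_le_one (by linarith)]; exact hn'
        gcongr
        exact mul_le_one₀ this (by positivity) (pow_le_one₀ hδ.le hδ1.le)
    _ = δ * N := one_mul _

/-! ### Runs of the algorithm -/

/-- The last clause is the greedy charging argument: each edge of `N` is paid for by the growth of
the total value when its buyer arrives and by the value of its seller. -/
theorem run_spec (x : Fin n → EuclideanSpace ℝ (Fin D)) {d : Fin n → ℕ} (hd : Monotone d)
    (hdl : ∀ i : Fin n, (i : ℕ) < d i) {sel : Finset (Fin n) → (Fin n → ℝ) → Fin n}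
    (hsel : IsArgmaxRule sel) (M : Matrix (Fin s) (Fin D) ℝ) (c : Fin n → Bool) (T : ℕ) :
    let σ := run x d sel M c T
    let σ' := run x d sel M (fun j => !c j) T
    Coupled (edgeWeight x) (min T n) σ σ' ∧ Valid d (query M x) (min T n) (min T n) σ ∧
      Valid d (query M x) (min T n) (min T n) σ' ∧
      (∀ i, i ∈ σ.sellers ↔ (i : ℕ) < T ∧ T ≤ d i) ∧
      ∀ N, IsCopyMatching d N → ∑ e ∈ N with (e.2 : ℕ) < T, query M x e.2 e.1 ≤
        ∑ i, σ.value i + ∑ e ∈ N with (e.2 : ℕ) < T, σ.value e.1 := by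
  induction T with
  | zero =>
    rw [Nat.zero_min]
    refine ⟨Coupled.init, Valid.init, Valid.init, ?_, ?_⟩ <;> simp [run, State.init]
  | succ T ih =>
    obtain ⟨h1, h2, h3, h4, h5⟩ := ih
    simp only [run]
    set σ := run x d sel M c T
    set σ' := run x d sel M (fun j => !c j) T
    rcases Nat.lt_or_ge T n with hT | hT
    · rw [min_eq_left hT.le] at h1 h2 h3
      rw [min_eq_left (by omega : T + 1 ≤ n)]
      simp only [step, dif_pos hT]
      obtain ⟨r1, r2, r3, r4, r5⟩ := expireAll_spec hd c T (h1.arrive h2 hT) (h2.arrive hT)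
        (h3.arrive hT) (by
          intro i
          show i ∈ insert _ _ ↔ _
          rw [Finset.mem_insert, h4]
          have := hdl ⟨T, hT⟩
          constructor
          · rintro (rfl | ⟨q1, q2⟩)
            · exact ⟨by simp, this.le⟩
            · exact ⟨by omega, q2⟩
          · rintro ⟨q1, q2⟩
            by_cases q : (i : ℕ) = T
            · exact Or.inl (Fin.ext q)
            · exact Or.inr ⟨by omega, q2⟩) (fun i hi => by have := hdl i; omega)
      obtain ⟨u1, u2, u3, u4, u5, u6⟩ := assign_spec hsel (W := query M x) (by simp [query])
        ⟨T, hT⟩ r1 r2 r3 r4 (hdl ⟨T, hT⟩)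
      refine ⟨u1, u2, u3, ?_, ?_⟩
      · intro i
        rw [u4]; exact r4 i
      · intro N hN
        rw [r5, h2.arrive_value] at u5 u6
        set τ := State.assign sel (query M x ⟨T, hT⟩) _ ⟨T, hT⟩
        have hold := h5 N hN
        have hmono : ∑ e ∈ N with (e.2 : ℕ) < T, σ.value e.1 ≤
            ∑ e ∈ N with (e.2 : ℕ) < T, τ.value e.1 := Finset.sum_le_sum fun e _ => u5 _
        have hmono2 : ∑ i, σ.value i ≤ ∑ i, τ.value i := Finset.sum_le_sum fun e _ => u5 _
        by_cases hex : ∃ e ∈ N, (e.2 : ℕ) = T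
        · obtain ⟨e, he, heT⟩ := hex
          have hfil : (N.filter fun e => (e.2 : ℕ) < T + 1) =
              insert e (N.filter fun e => (e.2 : ℕ) < T) := by
            ext f
            rw [Finset.mem_insert, Finset.mem_filter, Finset.mem_filter]
            constructor
            · rintro ⟨q1, q2⟩
              by_cases q : (f.2 : ℕ) = T
              · exact Or.inl (hN.2.2 f q1 e he (Fin.ext (q.trans heT.symm)))
              · exact Or.inr ⟨q1, by omega⟩
            · rintro (rfl | ⟨q1, q2⟩)
              · exact ⟨he, by omega⟩
              · exact ⟨q1, by omega⟩
          have hnot : e ∉ N.filter fun e => (e.2 : ℕ) < T := by simp [heT]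
          have he2 : e.2 = ⟨T, hT⟩ := Fin.ext heT
          have hlt : (e.1 : ℕ) < e.2 := (hN.1 e he).1
          -- The seller of this edge is still in the market, so the greedy choice gained at least as
          -- much as this edge would have.
          have := u6 e.1 ((r4 _).2 ⟨by omega, by have := (hN.1 e he).2; omega⟩)
          rw [hfil, Finset.sum_insert hnot, Finset.sum_insert hnot, he2]
          have := u5 e.1
          linarith
        · push Not at hex
          have hfil : (N.filter fun e => (e.2 : ℕ) < T + 1) =
              N.filter fun e => (e.2 : ℕ) < T := by
            refine Finset.filter_congr fun e he => ?_
            have := hex e he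
            omega
          rw [hfil]
          linarith
    · rw [min_eq_right hT] at h1 h2 h3
      rw [min_eq_right (by omega : n ≤ T + 1)]
      simp only [step, dif_neg (not_lt.2 hT)]
      obtain ⟨r1, r2, r3, r4, r5⟩ := expireAll_spec hd c T h1 h2 h3 (by
        intro i
        rw [h4]
        have := i.2
        constructor <;> rintro ⟨q1, q2⟩ <;> exact ⟨by omega, q2⟩) (fun i _ => i.2)
      refine ⟨r1, r2, r3, ?_, ?_⟩
      · intro i
        rw [r4]
        have := i.2
        constructor <;> rintro ⟨q1, q2⟩ <;> exact ⟨by omega, q2⟩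
      · intro N hN
        rw [r5]
        have hfil : ∀ m, n ≤ m → (N.filter fun e => (e.2 : ℕ) < m) = N := fun m hm =>
          Finset.filter_true_of_mem fun e _ => by have := e.2.2; omega
        have := h5 N hN
        rw [hfil _ hT] at this
        rwa [hfil _ (by omega)]

/-! ### Matching property and competitive ratio -/

theorem isNodeMatching_of_valid {d : Fin n → ℕ} {W : Fin n → Fin n → ℝ} {a b : ℕ} {σ : State n}
    (h : Valid d W a b σ) : IsNodeMatching d σ.matching := by
  refine ⟨⟨?_, ?_, ?_⟩, ?_⟩
  · intro e he
    obtain ⟨q1, -, q2, -⟩ := h.partner_spec _ _ (h.matching_spec e he).2.1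
    exact ⟨q1, q2⟩
  · intro e he e' he' q
    have q1 := (h.matching_spec e he).2.1
    have q2 := (h.matching_spec e' he').2.1
    rw [q, q2] at q1
    exact Prod.ext q (Option.some.inj q1).symm
  · intro e he e' he' q
    have q1 := (h.matching_spec e he).2.1
    have q2 := (h.matching_spec e' he').2.1
    rw [← q] at q2
    exact Prod.ext (h.partner_inj _ _ _ q1 q2) q
  · intro e he e' he' q
    have q1 := (h.matching_spec e he).2.2.1
    have q2 := (h.matching_spec e' he').2.2.2
    rw [q, q2] at q1
    simp at q1

/-- If the sketch is faithful, opposite coins together collect half of the value of any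
matching between seller and buyer copies, up to the distortion. -/
theorem final_spec (x : Fin n → EuclideanSpace ℝ (Fin D)) {d : Fin n → ℕ} (hd : Monotone d)
    (hdl : ∀ i : Fin n, (i : ℕ) < d i) {sel : Finset (Fin n) → (Fin n → ℝ) → Fin n}
    (hsel : IsArgmaxRule sel) {η : ℝ} (hη : 0 ≤ η) (R : Fin s → Fin D → Bool)
    (hR : ∀ i j : Fin n, i < j → Faithful η R (x j) (x i))
    (c : Fin n → Bool) {N : Finset (Fin n × Fin n)} (hN : IsCopyMatching d N) :
    let τ := final x d sel (sketchMatrix R) c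
    let τ' := final x d sel (sketchMatrix R) (fun j => !c j)
    (1 - η) / 2 * totalWeight x N ≤ τ.p + τ'.p ∧
      (1 - 2 * η) / 2 * totalWeight x N ≤ totalWeight x τ.matching + totalWeight x τ'.matching := by
  intro τ τ'
  obtain ⟨h1, h2, -, h4, h5⟩ := run_spec x hd hdl hsel (sketchMatrix R) c
    (Finset.univ.sup fun i => d i + 1)
  set T := Finset.univ.sup fun i => d i + 1 with hT
  set W := query (sketchMatrix R) x
  change Coupled (edgeWeight x) (min T n) τ τ' at h1
  change Valid d W (min T n) (min T n) τ at h2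
  have hle : ∀ i, d i + 1 ≤ T := fun i => Finset.le_sup (f := fun i => d i + 1) (Finset.mem_univ i)
  have hexp : τ.expired (min T n) = Finset.univ := by
    ext i
    have q1 := hle i
    have q2 := hdl i
    have q3 := i.2
    have : i ∉ τ.sellers := fun q => by have := ((h4 i).1 q).2; omega
    simp only [State.mem_expired, Finset.mem_univ, iff_true]
    exact ⟨by omega, this⟩
  have hW0 : ∀ i j, 0 ≤ W i j := fun i j => norm_nonneg _
  have hv0 := h2.value_nonneg hW0
  have hgreedy := h5 N hN
  have hfil : (N.filter fun e => (e.2 : ℕ) < T) = N :=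
    Finset.filter_true_of_mem fun e _ => by have := hle e.2; have := hdl e.2; omega
  change ∑ e ∈ N with (e.2 : ℕ) < T, W e.2 e.1 ≤
    ∑ i, τ.value i + ∑ e ∈ N with (e.2 : ℕ) < T, τ.value e.1 at hgreedy
  rw [hfil] at hgreedy
  -- Distinct edges of `N` have distinct sellers; this gives the greedy factor 2.
  have hN1 : ∑ e ∈ N, τ.value e.1 ≤ ∑ i, τ.value i := by
    rw [← Finset.sum_image (s := N) (g := Prod.fst) (f := τ.value)
      (fun e he e' he' q => hN.2.1 e he e' he' q)]
    exact Finset.sum_le_sum_of_subset_of_nonneg (Finset.subset_univ _) fun i _ _ => hv0 i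
  have hN2 : (1 - η) * totalWeight x N ≤ ∑ e ∈ N, W e.2 e.1 := by
    rw [totalWeight, Finset.mul_sum]
    exact Finset.sum_le_sum fun e he => (hR _ _ (hN.1 e he).1).1
  have hp := h1.p_add
  have hw := h1.weight_add
  rw [hexp] at hp hw
  have hvw : ∑ i, τ.value i ≤ (1 + η) * ∑ i, (τ.partner i).elim 0 (edgeWeight x i) := by
    rw [Finset.mul_sum]
    refine Finset.sum_le_sum fun i _ => ?_
    rcases hpi : τ.partner i with _ | l
    · simp [h2.value_none i hpi]
    · obtain ⟨q1, -, -, q2⟩ := h2.partner_spec i l hpi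
      rw [q2]
      exact (hR _ _ q1).2
  have hN0 : 0 ≤ totalWeight x N := Finset.sum_nonneg fun e _ => norm_nonneg _
  refine ⟨by linarith, ?_⟩
  change totalWeight x τ.matching + totalWeight x τ'.matching = _ at hw
  rw [← hw] at hvw
  set Y := totalWeight x τ.matching + totalWeight x τ'.matching
  -- The two distortions combine through `(1 - 2η)(1 + η) ≤ 1 - η`.
  refine le_of_mul_le_mul_left ?_ (by linarith : 0 < 1 + η)
  nlinarith [mul_nonneg (mul_nonneg hη hη) hN0]

/-- Flipping all coins is a bijection of the coin vectors, so a bound on opposite pairs is a bound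
on the average. -/
theorem le_coinExpect {f : (Fin n → Bool) → ℝ} {B : ℝ}
    (h : ∀ c, 2 * B ≤ f c + f fun j => !c j) : B ≤ coinExpect f := by
  have hflip : ∑ c : Fin n → Bool, f (fun j => !c j) = ∑ c, f c :=
    ((Equiv.refl (Fin n)).arrowCongr Equiv.boolNot).sum_comp f
  have h1 : ∑ c : Fin n → Bool, 2 * B ≤ ∑ c, (f c + f fun j => !c j) :=
    Finset.sum_le_sum fun c _ => h c
  rw [Finset.sum_add_distrib, hflip, Finset.sum_const, nsmul_eq_mul] at h1
  rw [coinExpect, Finset.expect_eq_sum_div_card, le_div_iff₀ (Nat.cast_pos.2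
    Finset.univ_nonempty.card_pos)]
  linarith

theorem mul_opt_le {x : Fin n → EuclideanSpace ℝ (Fin D)} {d : Fin n → ℕ} {k B : ℝ} (hk : 0 < k)
    (h : ∀ N, IsCopyMatching d N → k * totalWeight x N ≤ B) : k * opt x d ≤ B := by
  rw [← le_div_iff₀' hk]
  refine csSup_le ⟨_, ∅, ⟨by simp, by simp, by simp⟩, rfl⟩ ?_
  rintro _ ⟨N, hN, rfl⟩
  exact (le_div_iff₀' hk).2 (h N hN)

end FPG

theorem mainTheorem2 :
    ∃ C₀ : ℝ, 0 < C₀ ∧ ∀ C : ℝ, C₀ ≤ C →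
      ∀ (ε δ : ℝ), 0 < ε → ε < 1 → 0 < δ → δ < 1 →
      ∀ (n D : ℕ) (x : Fin n → EuclideanSpace ℝ (Fin D)) (d : Fin n → ℕ),
        Monotone d → (∀ i : Fin n, (i : ℕ) < d i) →
      ∀ sel : Finset (Fin n) → (Fin n → ℝ) → Fin n, FPG.IsArgmaxRule sel →
        (∀ (signs : Fin (FPG.sketchDim C ε δ n) → Fin D → Bool) (coins : Fin n → Bool),
          FPG.IsNodeMatching d (FPG.final x d sel (FPG.sketchMatrix signs) coins).matching) ∧
        ENNReal.ofReal (1 - δ) ≤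
          FPG.signLaw (FPG.sketchDim C ε δ n) D
            {signs |
              (1 - ε) / 4 * FPG.opt x d ≤
                FPG.coinExpect (fun coins => FPG.totalWeight x
                  (FPG.final x d sel (FPG.sketchMatrix signs) coins).matching) ∧
              (1 - ε) / 4 * FPG.opt x d ≤
                FPG.coinExpect (fun coins =>
                  (FPG.final x d sel (FPG.sketchMatrix signs) coins).p)} := by
  refine ⟨192, by norm_num, fun C hC ε δ hε hε1 hδ hδ1 n D x d hd hdl sel hsel => ⟨?_, ?_⟩⟩
  · intro R c
    exact FPG.isNodeMatching_of_valid
      (FPG.run_spec x hd hdl hsel (FPG.sketchMatrix R) c (Finset.univ.sup fun i => d i + 1)).2.1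
  · refine (FPG.le_signLaw_faithful hC hε hε1 hδ hδ1 x).trans (MeasureTheory.measure_mono ?_)
    intro R hR
    have hfin := fun c N (hN : FPG.IsCopyMatching d N) =>
      FPG.final_spec x hd hdl hsel (by linarith : 0 ≤ ε / 2) R hR c hN
    constructor
    · refine FPG.mul_opt_le (by linarith) fun N hN => FPG.le_coinExpect fun c => ?_
      have := (hfin c N hN).2
      linarith
    · refine FPG.mul_opt_le (by linarith) fun N hN => FPG.le_coinExpect fun c => ?_
      have := (hfin c N hN).1
      have h0 : 0 ≤ ε * FPG.totalWeight x N :=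
        mul_nonneg hε.le (Finset.sum_nonneg fun e _ => norm_nonneg _)
      linarith
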